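/- Let $(b_j)_{j\ge 0}$ be real numbers with $b_j\ge 0$ for $j\ne 1$, $0<-b_1=\sum_{j\neq 1}b_j<\infty$ and $b_0>0$, and let $w_i>0$ for $i\ge 1$. Put $q_{ij}=w_ib_{j-i+1}$ for $i\ge 1$, $j\ge i-1$, and $q_{ij}=0$ otherwise. A weighted Markov branching process (WMBP) is a regular (i.e. non-explosive, with right-continuous step-function paths) continuous-time Markov chain $(X(t))_{t\ge0}$ on $\{0,1,2,\dots\}$ with $Q$-matrix $Q=(q_{ij})$ whose transition function satisfies the forward equation $p_{ij}'(t)=\sum_{k\ge0}p_{ik}(t)q_{kj}$, $i\ge 0$, $j\ge 1$, $t\ge 0$. Let $\tau=\inf\{t\ge 0: X(t)=0\}$ be the extinction time, and let $Y_0(\tau)$ be the number of deaths, i.e. of times $0<s\le\tau$ with $X(s)=X(s-)-1$. Let $\rho$ be the minimal nonnegative root of $B(u)=\sum_{j\ge0}b_ju^j=0$, and let $(\rho_k)_{k\ge0}$ be the sequence determined by $$\rho_0=0,\qquad \rho_1=-b_1^{-1}b_0,\qquad \rho_{k+1}=-b_1^{-1}\sum_{j=2}^{k+1}b_j\,\rho^{*(j)}_{k+1}\quad(k\ge1),$$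 where $\rho^{*(j)}_{l}=\sum_{k_1+\cdots+k_j=l}\rho_{k_1}\cdots\rho_{k_j}$ is the $j$-th convolution. (The minimal root exists, and the recursion has exactly one solution.) If $X$ is a WMBP with $X(0)=1$, then the probability generating function of $Y_0(\tau)$ conditioned on $\tau<\infty$ is $$G(v)=E\big[v^{Y_0(\tau)}\,\big|\,\tau<\infty\big]=\rho^{-1}\sum_{k=0}^\infty\rho_kv^k,\qquad v\in[0,1],$$ and hence $$P(Y_0(\tau)=k\mid\tau<\infty)=\rho^{-1}\rho_k,\qquad k\ge0.$$ The same two formulas hold for the number of deaths of an ordinary Markov branching process (the case $w_i=i$) started at $1$. They also hold for the number of services in a busy period of an $M^X/M/1$ queue, i.e. for the number of down-jumps of $X$ in $(0,\tau]$ when $X$ is the queue length process with $X(0)=1$, single services at rate $b_0$ and arrivals of batches of size $m\ge1$ at rate $b_{m+1}$ (also when the system is empty). -/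

import Mathlib

open MeasureTheory Filter Topology
open scoped NNReal ENNReal

namespace WMBP

/-- The conditions on the rates `(b_j)`: `b_j ≥ 0` for `j ≠ 1` and
`0 < -b_1 = ∑_{j ≠ 1} b_j < ∞`. -/
structure IsRateSequence (b : ℕ → ℝ) : Prop where
  nonneg : ∀ j, j ≠ 1 → 0 ≤ b j
  neg_one_pos : 0 < -b 1
  hasSum : HasSum (fun j : {j : ℕ // j ≠ 1} => b j) (-b 1)

/-- The weighted branching `Q`-matrix: `q_{ij} = w_i b_{j-i+1}` if `i ≥ 1` and `j ≥ i - 1`, and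
`q_{ij} = 0` otherwise. The state `0` is absorbing. -/
noncomputable def wmbMatrix (b w : ℕ → ℝ) (i j : ℕ) : ℝ :=
  if 1 ≤ i ∧ i ≤ j + 1 then w i * b (j + 1 - i) else 0

/-- The `Q`-matrix of the queue length (customers in the system) of an `M^X/M/1` queue in which
customers are served one at a time at rate `b_0` and batches of size `m ≥ 1` arrive at rate
`b_{m+1}`. Arrivals also occur when the system is empty. -/
noncomputable def queueMatrix (b : ℕ → ℝ) (i j : ℕ) : ℝ :=
  if i = 0 then (if j = 0 then b 0 + b 1 else b (j + 1)) else wmbMatrix b (fun _ => 1) i j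

/-- `p t i j` (for `t ≥ 0`) is an honest transition function on `ℕ`. Its values at negative `t`
play no role. -/
structure IsTransitionFunction (p : ℝ → ℕ → ℕ → ℝ) : Prop where
  nonneg : ∀ t, 0 ≤ t → ∀ i j, 0 ≤ p t i j
  hasSum_one : ∀ t, 0 ≤ t → ∀ i, HasSum (fun j => p t i j) 1
  zero : ∀ i j, p 0 i j = if i = j then 1 else 0
  chapmanKolmogorov : ∀ s t, 0 ≤ s → 0 ≤ t → ∀ i j,
    HasSum (fun k => p s i k * p t k j) (p (s + t) i j)

/-- The infinitesimal generator of `p` is `Q`, that is `p'_{ij}(0) = q_{ij}`. -/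
def HasGenerator (p : ℝ → ℕ → ℕ → ℝ) (Q : ℕ → ℕ → ℝ) : Prop :=
  ∀ i j, HasDerivWithinAt (fun t => p t i j) (Q i j) (Set.Ici 0) 0

/-- The forward equation `p'_{ij}(t) = ∑_k p_{ik}(t) q_{kj}`, `i ≥ 0`, `j ≥ 1`, `t ≥ 0`. -/
def SatisfiesForwardEquation (p : ℝ → ℕ → ℕ → ℝ) (Q : ℕ → ℕ → ℝ) : Prop :=
  ∀ i j, 1 ≤ j → ∀ t, 0 ≤ t →
    Summable (fun k => p t i k * Q k j) ∧
    HasDerivWithinAt (fun t => p t i j) (∑' k, p t i k * Q k j) (Set.Ici 0) t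

/-- The Markov property of `X` with transition function `p`: for every event `A` of the past
`σ(X(u); u ≤ s)`, `P(A, X(s) = i, X(s+t) = j) = P(A, X(s) = i) p_{ij}(t)`. -/
def IsMarkovWith {Ω : Type*} [MeasurableSpace Ω] (P : Measure Ω) (p : ℝ → ℕ → ℕ → ℝ) (X : ℝ≥0 → Ω → ℕ) : Prop :=
  ∀ (s t : ℝ≥0) (i j : ℕ) (A : Set Ω),
    MeasurableSet[⨆ u : Set.Iic s, MeasurableSpace.comap (X u) inferInstance] A →
      P.real (A ∩ {ω | X s ω = i} ∩ {ω | X (s + t) ω = j}) =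
        P.real (A ∩ {ω | X s ω = i}) * p t i j

/-- `X` is a regular continuous-time Markov chain with state space `ℕ` and `Q`-matrix `Q`.
Regular means that it does not explode: with `ℕ` discrete, right-continuous paths with left
limits in `ℕ` are exactly the right-continuous step functions with finitely many jumps in every
bounded time interval. -/
structure IsRegularChain {Ω : Type*} [MeasurableSpace Ω] (P : Measure Ω) (Q : ℕ → ℕ → ℝ) (X : ℝ≥0 → Ω → ℕ) : Prop where
  measurable : ∀ t, Measurable (X t)
  rightContinuous : ∀ᵐ ω ∂P, ∀ t, ContinuousWithinAt (fun s => X s ω) (Set.Ici t) t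
  leftLimits : ∀ᵐ ω ∂P, ∀ t, ∃ l : ℕ, Tendsto (fun s => X s ω) (𝓝[<] t) (𝓝 l)
  markov : ∃ p, IsTransitionFunction p ∧ HasGenerator p Q ∧ SatisfiesForwardEquation p Q ∧
    IsMarkovWith P p X

/-- A (regular) weighted Markov branching process with rates `b` and weights `w`. -/
def IsWeightedMarkovBranchingProcess {Ω : Type*} [MeasurableSpace Ω]
    (P : Measure Ω) (b w : ℕ → ℝ) (X : ℝ≥0 → Ω → ℕ) : Prop :=
  IsRegularChain P (wmbMatrix b w) X

/-- A (regular) ordinary Markov branching process: the weights are `w_i = i`. -/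
def IsMarkovBranchingProcess {Ω : Type*} [MeasurableSpace Ω] (P : Measure Ω) (b : ℕ → ℝ) (X : ℝ≥0 → Ω → ℕ) : Prop :=
  IsRegularChain P (wmbMatrix b (fun i => (i : ℝ))) X

/-- The queue length process of an `M^X/M/1` queue. -/
def IsMXM1Queue {Ω : Type*} [MeasurableSpace Ω] (P : Measure Ω) (b : ℕ → ℝ) (X : ℝ≥0 → Ω → ℕ) : Prop :=
  IsRegularChain P (queueMatrix b) X

/-- `τ = inf {t ≥ 0 : X(t) = 0}`, equal to `∞` if there is no such `t`. -/
noncomputable def extinctionTime {Ω : Type*} (X : ℝ≥0 → Ω → ℕ) (ω : Ω) : ℝ≥0∞ :=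
  ⨅ (t : ℝ≥0) (_ : X t ω = 0), (t : ℝ≥0∞)

/-- `Y_0(T)`: the number of times `0 < s ≤ T` with `X(s-) = X(s) + 1`, i.e. of jumps of size `-1`
up to time `T`. -/
noncomputable def deathCount {Ω : Type*} (X : ℝ≥0 → Ω → ℕ) (T : ℝ≥0∞) (ω : Ω) : ℕ∞ :=
  Set.encard {s : ℝ≥0 | 0 < s ∧ (s : ℝ≥0∞) ≤ T ∧ ∀ᶠ r in 𝓝[<] s, X r ω = X s ω + 1}

/-- `Y_0(τ)`: the number of deaths (services) until extinction (the end of the busy period). -/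
noncomputable def totalDeaths {Ω : Type*} (X : ℝ≥0 → Ω → ℕ) (ω : Ω) : ℕ∞ :=
  deathCount X (extinctionTime X ω) ω

/-- The nonnegative roots of `B(u) = ∑_j b_j u^j` (where the series converges). -/
def nonnegRoots (b : ℕ → ℝ) : Set ℝ :=
  {u | 0 ≤ u ∧ HasSum (fun j => b j * u ^ j) 0}

/-- The `j`-th convolution `f^{*(j)}_l = ∑_{k_1 + ⋯ + k_j = l} f_{k_1} ⋯ f_{k_j}`. -/
def convolution (f : ℕ → ℝ) (j l : ℕ) : ℝ :=
  ∑ k ∈ Finset.piAntidiag (Finset.univ : Finset (Fin j)) l, ∏ i, f (k i)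

/-- The recursion for `(ρ_k)`. -/
structure IsDeathSequence (b r : ℕ → ℝ) : Prop where
  zero : r 0 = 0
  one : r 1 = -(b 1)⁻¹ * b 0
  succ : ∀ k, 1 ≤ k →
    r (k + 1) = -(b 1)⁻¹ * ∑ j ∈ Finset.Icc 2 (k + 1), b j * convolution r j (k + 1)

/-- Conditioned on `τ < ∞`, the distribution of `Y_0(τ)` is `ρ_k / ρ`, `k ≥ 0`, and its probability
generating function is `G(v) = ρ⁻¹ ∑_k ρ_k v^k` on `[0, 1]`. -/
structure HasDeathLaw {Ω : Type*} [MeasurableSpace Ω] (P : Measure Ω) (X : ℝ≥0 → Ω → ℕ)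
    (ρ : ℝ) (r : ℕ → ℝ) : Prop where
  law : ∀ k : ℕ,
    (ProbabilityTheory.cond P {ω | extinctionTime X ω < ∞}).real {ω | totalDeaths X ω = k} =
      ρ⁻¹ * r k
  integrable_pgf : ∀ v ∈ Set.Icc (0 : ℝ) 1,
    Integrable (fun ω => v ^ (totalDeaths X ω).toNat)
      (ProbabilityTheory.cond P {ω | extinctionTime X ω < ∞})
  summable_pgf : ∀ v ∈ Set.Icc (0 : ℝ) 1, Summable (fun k => r k * v ^ k)
  pgf : ∀ v ∈ Set.Icc (0 : ℝ) 1,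
    ∫ ω, v ^ (totalDeaths X ω).toNat ∂(ProbabilityTheory.cond P {ω | extinctionTime X ω < ∞}) =
      ρ⁻¹ * ∑' k, r k * v ^ k

end WMBP

/-!
The extinction time and the number of deaths up to it depend on the path only through the sequence
of its distinct successive states, that is through the embedded jump chain. Off `0` this chain is,
for each of the three processes, the random walk that jumps from `i` to `i - 1 + m` with probability
`b_m / (-b_1)`, `m ≠ 1`: the weights `w_i` cancel.

To get the law of the jump chain from the transition function, the chain is observed at the times
`0, h, 2h, …` only. This skeleton is a Markov chain in discrete time whose distinct successive
states have transition probabilities `p_{ij}(h) / (1 - p_{ii}(h))`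
(`IsMarkovWith.measure_follows_skeleton`), and these tend to `q_{ij} / (-q_{ii})` as `h → 0`. As
paths are right-continuous step functions, a path follows a given finite word of states if and only
if its skeletons of small mesh do (`eventually_follows_skeleton_iff`). Hence the probability of a
word is the product of its jump probabilities (`IsRegularChain.measure_follows`).

Paths without explosion that hit `0` do so after finitely many jumps, so the event
`{τ < ∞, Y_0(τ) = k}` is the disjoint union of the events that the path follows a given word from
`1` to `0` with `k` deaths. Let `S(i, k)` be the sum of the probabilities of the words from `i` to
`0` with `k` deaths. First step analysis gives
`S(i, k) = a_0 S(i - 1, k - 1) + ∑_{m ≥ 2} a_m S(i - 1 + m, k)` with `a_m = b_m / (-b_1)`, and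
`S(i, k) = 0` for `k < i`. These relations determine `S`, and the convolution powers of the death
sequence satisfy them as well, so `S(1, k) = ρ_k` (`wordSum_eq_coeff`).

It remains to see that `∑_k ρ_k` is the minimal nonnegative root of `B`
(`IsDeathSequence.exists_isLeast`). Summing the recursion shows that it is a fixed point of
`u ↦ a_0 + ∑_{m ≥ 2} a_m u^m`, and an induction on partial sums bounds it by any other one. All sums
are taken in `ℝ≥0∞`, where convergence is no issue; that they are finite follows from the
root `1`.
-/

namespace WMBP

/-! ### Jump words of paths -/

/-- From time `s` on, the path `x` starts in the state `i` and its next values are, in this order,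
the entries of `l`: it stays in `i` until it jumps to the head of `l`, and so on. What happens
after the arrival in the last state is not restricted. The time set `T` is `ℝ≥0` for paths of the
process and `ℕ` for paths of its discrete skeletons. -/
def Follows {T : Type*} [Preorder T] (x : T → ℕ) : T → ℕ → List ℕ → Prop
  | s, i, [] => x s = i
  | s, i, j :: l => ∃ t, s < t ∧ (∀ u, s ≤ u → u < t → x u = i) ∧ Follows x t j l

/-- The word `i, l` changes its state at each step and reaches `0` at its last letter and not
earlier. -/
def IsHit : ℕ → List ℕ → Prop
  | i, [] => i = 0
  | i, j :: l => i ≠ 0 ∧ i ≠ j ∧ IsHit j l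

/-- The number of steps by `-1` in the word `i, l`. -/
def downs : ℕ → List ℕ → ℕ
  | _, [] => 0
  | i, j :: l => (if i = j + 1 then 1 else 0) + downs j l

section Follows

variable {T : Type*} [LinearOrder T] {x : T → ℕ}

lemma Follows.eq : ∀ {l : List ℕ} {s : T} {i : ℕ}, Follows x s i l → x s = i
  | [], _, _, h => h
  | _ :: _, s, _, ⟨_, hst, h, _⟩ => h s le_rfl hst

/-- If `t` is the first time after `s` at which `x` leaves `i`, then the second letter of a word
followed from `s` is the state at time `t`. -/
lemma follows_cons_iff_of_exit {s t : T} {i j : ℕ} {l : List ℕ} (hst : s < t)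
    (hc : ∀ u, s ≤ u → u < t → x u = i) (ht : x t ≠ i) (hij : i ≠ j) :
    Follows x s i (j :: l) ↔ Follows x t j l := by
  refine ⟨?_, fun h => ⟨t, hst, hc, h⟩⟩
  rintro ⟨t', hst', hc', h⟩
  rcases lt_trichotomy t t' with h1 | rfl | h1
  · exact absurd (hc' t hst.le h1) ht
  · exact h
  · exact absurd ((hc t' hst'.le h1).symm.trans h.eq) hij

/-- A path follows at most one word that ends with its first visit to `0`. -/
lemma Follows.unique : ∀ {l l' : List ℕ} {s : T} {i : ℕ}, Follows x s i l → Follows x s i l' →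
    IsHit i l → IsHit i l' → l = l'
  | [], [], _, _, _, _, _, _ => rfl
  | [], _ :: _, _, _, _, _, h, h' => absurd h h'.1
  | _ :: _, [], _, _, _, _, h, h' => absurd h' h.1
  | j :: l, j' :: l', s, i, ⟨t, hst, hc, h⟩, hx', hh, hh' => by
    have ht : x t ≠ i := fun e => hh.2.1 (e.symm.trans h.eq)
    have h' := (follows_cons_iff_of_exit hst hc ht hh'.2.1).1 hx'
    obtain rfl : j = j' := h.eq.symm.trans h'.eq
    rw [Follows.unique h h' hh.2.2 hh'.2.2]

end Follows

/-- The discrete skeleton of `x` with mesh `h`. -/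
def skeleton (x : ℝ≥0 → ℕ) (h : ℝ≥0) (m : ℕ) : ℕ := x (m * h)

lemma exists_const_Ico {x : ℝ≥0 → ℕ} (hr : ∀ t, ContinuousWithinAt x (Set.Ici t) t) (s : ℝ≥0) :
    ∃ c, s < c ∧ ∀ u, s ≤ u → u < c → x u = x s := by
  have h : ∀ᶠ u in 𝓝[≥] s, x u = x s := by
    have := hr s
    rw [ContinuousWithinAt, nhds_discrete, tendsto_pure] at this
    exact this
  obtain ⟨c, hc, hsub⟩ := mem_nhdsGE_iff_exists_Ico_subset.1 h
  exact ⟨c, hc, fun u h1 h2 => hsub ⟨h1, h2⟩⟩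

lemma eventually_ceil_mul_mem {s c : ℝ≥0} (hsc : s < c) :
    ∀ᶠ h in 𝓝[>] (0 : ℝ≥0), s ≤ (⌈s / h⌉₊ : ℝ≥0) * h ∧ (⌈s / h⌉₊ : ℝ≥0) * h < c := by
  have h1 : ∀ᶠ h in 𝓝[>] (0 : ℝ≥0), h < c - s :=
    nhdsWithin_le_nhds (Iio_mem_nhds (tsub_pos_of_lt hsc))
  filter_upwards [h1, self_mem_nhdsWithin] with h h1 (h0 : 0 < h)
  constructor
  · rw [← div_le_iff₀ h0]
    exact Nat.le_ceil _
  · calc (⌈s / h⌉₊ : ℝ≥0) * h < (s / h + 1) * h := by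
          gcongr
          exact Nat.ceil_lt_add_one (zero_le)
      _ = s + h := by rw [add_mul, div_mul_cancel₀ _ h0.ne', one_mul]
      _ < c := by
          rw [add_comm]
          exact lt_tsub_iff_right.1 h1

/-- Whether a right-continuous path follows a word can be read off from its skeletons of small
mesh. -/
lemma eventually_follows_skeleton_iff {x : ℝ≥0 → ℕ}
    (hr : ∀ t, ContinuousWithinAt x (Set.Ici t) t) :
    ∀ (l : List ℕ) (i : ℕ) (s : ℝ≥0), IsHit i l →
      ∀ᶠ h in 𝓝[>] (0 : ℝ≥0), Follows (skeleton x h) ⌈s / h⌉₊ i l ↔ Follows x s i l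
  | [], i, s, _ => by
    obtain ⟨c, hsc, hc⟩ := exists_const_Ico hr s
    filter_upwards [eventually_ceil_mul_mem hsc] with h hh
    simp only [Follows, skeleton, hc _ hh.1 hh.2]
  | j :: l, i, s, hl => by
    obtain ⟨c, hsc, hc⟩ := exists_const_Ico hr s
    by_cases hi : x s = i
    swap
    · filter_upwards [eventually_ceil_mul_mem hsc] with h hh
      refine iff_of_false (fun H => hi ?_) (fun H => hi H.eq)
      rw [← H.eq, skeleton, hc _ hh.1 hh.2]
    by_cases hex : ∃ u, s < u ∧ x u ≠ i
    swap
    · push Not at hex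
      filter_upwards [eventually_ceil_mul_mem hsc, self_mem_nhdsWithin] with h hh (h0 : 0 < h)
      refine iff_of_false ?_ ?_
      · rintro ⟨t, hst, -, H⟩
        refine hl.2.1 ((hex (t * h) (hh.1.trans_lt ?_)).symm.trans H.eq)
        gcongr
      · rintro ⟨t, hst, -, H⟩
        exact hl.2.1 ((hex t hst).symm.trans H.eq)
    -- `t` is the time of the first exit from `i`; by right continuity it is attained and `s < t`.
    set E := {u | s < u ∧ x u ≠ i} with hE
    have hne : E.Nonempty := hex
    set t := sInf E with ht
    have hlow : ∀ u, s ≤ u → u < t → x u = i := by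
      intro u hu hut
      rcases hu.eq_or_lt with rfl | hu
      · exact hi
      by_contra hne'
      exact absurd (csInf_le' (show u ∈ E from ⟨hu, hne'⟩)) (not_le.2 hut)
    have hst : s < t := by
      refine hsc.trans_le (le_csInf hne ?_)
      rintro u ⟨hu, hui⟩
      by_contra! huc
      exact hui ((hc u hu.le huc).trans hi)
    obtain ⟨d, htd, hd⟩ := exists_const_Ico hr t
    have hti : x t ≠ i := by
      intro e
      obtain ⟨u, huE, hud⟩ := exists_lt_of_csInf_lt hne htd
      exact huE.2 ((hd u (csInf_le' huE) hud).trans e)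
    filter_upwards [eventually_ceil_mul_mem hst, eventually_ceil_mul_mem htd,
      eventually_follows_skeleton_iff hr l j t hl.2.2, self_mem_nhdsWithin]
      with h hs1 ht1 hrec (h0 : 0 < h)
    rw [follows_cons_iff_of_exit hst hlow hti hl.2.1, ← hrec]
    refine follows_cons_iff_of_exit ?_ ?_ ?_ hl.2.1
    · rw [Nat.lt_ceil, lt_div_iff₀ h0]
      exact hs1.2
    · intro m hm1 hm2
      refine hlow _ ?_ ?_
      · rw [← div_le_iff₀ h0]
        exact Nat.ceil_le.1 hm1
      · rw [← lt_div_iff₀ h0]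
        exact Nat.lt_ceil.1 hm2
    · rw [skeleton, hd _ ht1.1 ht1.2]
      exact hti

/-- A right-continuous path with left limits that visits `0` makes only finitely many jumps before,
and so follows a finite word ending at the first visit to `0`. -/
lemma exists_follows_of_eq_zero {x : ℝ≥0 → ℕ} (hr : ∀ t, ContinuousWithinAt x (Set.Ici t) t)
    (hleft : ∀ t, ∃ l : ℕ, Tendsto x (𝓝[<] t) (𝓝 l)) {t : ℝ≥0} (ht : x t = 0) :
    ∃ l, IsHit (x 0) l ∧ Follows x 0 (x 0) l := by
  -- Go backwards in time: the set `S` of good starting times has no positive infimum.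
  set S := {s | ∃ l, IsHit (x s) l ∧ Follows x s (x s) l} with hS
  have hprep : ∀ s s', s < s' → s' ∈ S → (∀ u, s ≤ u → u < s' → x u = x s) → s ∈ S := by
    rintro s s' hss ⟨l, hl, hf⟩ hc
    by_cases h0 : x s = 0
    · exact ⟨[], h0, rfl⟩
    by_cases heq : x s = x s'
    · rw [← heq] at hl hf
      cases l with
      | nil => exact absurd hl h0
      | cons j l =>
        obtain ⟨t, hst, hct, hft⟩ := hf
        refine ⟨j :: l, hl, t, hss.trans hst, fun u hu hut => ?_, hft⟩
        rcases lt_or_ge u s' with h | h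
        · exact hc u hu h
        · exact hct u h hut
    · exact ⟨x s' :: l, ⟨h0, heq, hl⟩, s', hss, hc, hf⟩
  have hne : S.Nonempty := ⟨t, [], ht, rfl⟩
  have hinf : sInf S ∈ S := by
    obtain ⟨c, hsc, hc⟩ := exists_const_Ico hr (sInf S)
    obtain ⟨u, huS, huc⟩ := exists_lt_of_csInf_lt hne hsc
    rcases (csInf_le' huS).eq_or_lt with h | h
    · rwa [h]
    · exact hprep _ u h huS fun v h1 h2 => hc v h1 (h2.trans huc)
  rcases eq_zero_or_pos (sInf S) with h0 | h0
  · rw [h0] at hinf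
    exact hinf
  obtain ⟨c, hc⟩ := hleft (sInf S)
  rw [nhds_discrete, tendsto_pure] at hc
  obtain ⟨a, ha, hsub⟩ := (mem_nhdsLT_iff_exists_Ioo_subset' h0).1 hc
  obtain ⟨s, has, hs⟩ := exists_between (show a < sInf S from ha)
  have hsS : s ∈ S := hprep s _ hs hinf fun u h1 h2 =>
    (show x u = c from hsub ⟨has.trans_le h1, h2⟩).trans
      (show x s = c from hsub ⟨has, hs⟩).symm
  exact absurd (csInf_le' hsS) (not_le.2 hs)

/-- The time `u` is the time of a jump by `-1`. -/
def IsDeathTime (x : ℝ≥0 → ℕ) (u : ℝ≥0) : Prop := ∀ᶠ r in 𝓝[<] u, x r = x u + 1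

lemma isDeathTime_iff_of_const {x : ℝ≥0 → ℕ} {s u : ℝ≥0} {i : ℕ} (hsu : s < u)
    (hc : ∀ r, s ≤ r → r < u → x r = i) : IsDeathTime x u ↔ i = x u + 1 := by
  have hev : ∀ᶠ r in 𝓝[<] u, x r = i := by
    filter_upwards [Ioo_mem_nhdsLT hsu] with r hr using hc r hr.1.le hr.2
  have : (𝓝[<] u).NeBot := nhdsLT_neBot_of_exists_lt ⟨s, hsu⟩
  constructor
  · intro h
    obtain ⟨r, h1, h2⟩ := (hev.and h).exists
    exact h1.symm.trans h2
  · intro h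
    filter_upwards [hev] with r hr using hr.trans h

lemma Follows.exists_hit {x : ℝ≥0 → ℕ} : ∀ {l : List ℕ} {i : ℕ} {s : ℝ≥0}, Follows x s i l →
    IsHit i l → ∃ t, s ≤ t ∧ x t = 0 ∧ (∀ u, s ≤ u → u < t → x u ≠ 0) ∧
      Set.encard {u | s < u ∧ u ≤ t ∧ IsDeathTime x u} = downs i l
  | [], i, s, h, hl => by
    refine ⟨s, le_rfl, h.trans hl, fun u h1 h2 => absurd h1 (not_le.2 h2), ?_⟩
    rw [show {u | s < u ∧ u ≤ s ∧ IsDeathTime x u} = ∅ from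
      Set.eq_empty_of_forall_notMem fun u hu => absurd hu.1 (not_lt.2 hu.2.1)]
    simp [downs]
  | j :: l, i, s, ⟨t, hst, hc, hf⟩, hl => by
    obtain ⟨T, htT, hT, hpos, hcard⟩ := hf.exists_hit hl.2.2
    refine ⟨T, hst.le.trans htT, hT, fun u h1 h2 => ?_, ?_⟩
    · rcases lt_or_ge u t with h | h
      · rw [hc u h1 h]
        exact hl.1
      · exact hpos u h h2
    have ht : IsDeathTime x t ↔ i = j + 1 := by
      rw [isDeathTime_iff_of_const hst hc, hf.eq]
    have hset : {u | s < u ∧ u ≤ T ∧ IsDeathTime x u} =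
        (if i = j + 1 then {t} else ∅) ∪ {u | t < u ∧ u ≤ T ∧ IsDeathTime x u} := by
      ext u
      simp only [Set.mem_ofPred_eq, Set.mem_union]
      rcases lt_trichotomy u t with h | rfl | h
      · have h1 : u ∉ (if i = j + 1 then {t} else ∅ : Set ℝ≥0) := by
          split_ifs <;> simp [h.ne]
        simp only [h1, h.not_gt, false_and, or_self, iff_false]
        rintro ⟨h2, -, h3⟩
        rw [isDeathTime_iff_of_const h2 fun r h4 h5 => hc r h4 (h5.trans h), hc u h2.le h] at h3
        omega
      · split_ifs with h1 <;> simp [ht, h1, hst, htT]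
      · have h1 : u ∉ (if i = j + 1 then {t} else ∅ : Set ℝ≥0) := by
          split_ifs <;> simp [h.ne']
        simp [h1, h, hst.trans h]
    rw [hset, Set.encard_union_eq, hcard, downs]
    · split_ifs <;> simp
    · rw [Set.disjoint_left]
      intro u hu hu'
      split_ifs at hu
      · exact absurd hu'.1 (by simp_all)
      · exact hu

/-- A path that follows from time `0` a word ending with its first visit to `0` becomes extinct,
with as many deaths as the word has steps by `-1`. -/
lemma Follows.extinction {Ω : Type*} {X : ℝ≥0 → Ω → ℕ} {ω : Ω} {i : ℕ} {l : List ℕ}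
    (h : Follows (fun t => X t ω) 0 i l) (hl : IsHit i l) :
    extinctionTime X ω < ∞ ∧ totalDeaths X ω = downs i l := by
  obtain ⟨t, -, ht, hpos, hcard⟩ := h.exists_hit hl
  have hτ : extinctionTime X ω = t := by
    refine le_antisymm (iInf₂_le t ht) (le_iInf₂ fun u hu => ?_)
    rw [ENNReal.coe_le_coe]
    by_contra! hut
    exact hpos u (zero_le) hut hu
  refine ⟨hτ ▸ ENNReal.coe_lt_top, ?_⟩
  rw [← hcard, totalDeaths, deathCount, hτ]
  simp only [ENNReal.coe_le_coe, IsDeathTime]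

/-! ### The law of the jump words -/

/-- The product of the one-step weights `κ` along the word `i, l`. -/
noncomputable def wordWeight (κ : ℕ → ℕ → ℝ≥0∞) : ℕ → List ℕ → ℝ≥0∞
  | _, [] => 1
  | i, j :: l => κ i j * wordWeight κ j l

section Markov

variable {Ω : Type*} {X : ℝ≥0 → Ω → ℕ}

/-- The past `σ(X(u); u ≤ s)`. -/
abbrev past (X : ℝ≥0 → Ω → ℕ) (s : ℝ≥0) : MeasurableSpace Ω :=
  ⨆ u : Set.Iic s, MeasurableSpace.comap (X u) inferInstance

lemma past_mono {s t : ℝ≥0} (hst : s ≤ t) : past X s ≤ past X t :=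
  iSup_le fun u => le_iSup (fun u : Set.Iic t => MeasurableSpace.comap (X u) inferInstance)
    ⟨u.1, le_trans u.2 hst⟩

lemma measurableSet_past_eq {u s : ℝ≥0} (hus : u ≤ s) (i : ℕ) :
    MeasurableSet[past X s] {ω | X u ω = i} :=
  le_iSup (fun u : Set.Iic s => MeasurableSpace.comap (X u) inferInstance) ⟨u, hus⟩ _
    ⟨{i}, measurableSet_singleton i, rfl⟩

/-- The event that the skeleton of mesh `h` is in `i` at the `n + 1` times `m, …, m + n`. -/
def stays (X : ℝ≥0 → Ω → ℕ) (h : ℝ≥0) (m i n : ℕ) : Set Ω :=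
  {ω | ∀ k ≤ n, X ((m + k : ℕ) * h) ω = i}

lemma stays_zero (h : ℝ≥0) (m i : ℕ) : stays X h m i 0 = {ω | X (m * h) ω = i} := by
  ext ω
  simp [stays]

lemma stays_succ (h : ℝ≥0) (m i n : ℕ) :
    stays X h m i (n + 1) = stays X h m i n ∩ {ω | X ((m + (n + 1) : ℕ) * h) ω = i} := by
  ext ω
  simp only [stays, Set.mem_ofPred_eq, Set.mem_inter_iff]
  constructor
  · exact fun H => ⟨fun k hk => H k (by omega), H _ le_rfl⟩
  · rintro ⟨H, H'⟩ k hk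
    rcases Nat.le_succ_iff.1 hk with h | rfl
    · exact H k h
    · exact H'

lemma measurableSet_past_stays (h : ℝ≥0) (m i n : ℕ) :
    MeasurableSet[past X ((m + n : ℕ) * h)] (stays X h m i n) := by
  have : stays X h m i n = ⋂ k, ⋂ (_ : k ≤ n), {ω | X ((m + k : ℕ) * h) ω = i} := by
    ext ω
    simp [stays]
  rw [this]
  refine MeasurableSet.iInter fun k => MeasurableSet.iInter fun hk => measurableSet_past_eq ?_ _
  gcongr

lemma follows_skeleton_cons (h : ℝ≥0) (m i j : ℕ) (l : List ℕ) :
    {ω | Follows (skeleton (fun t => X t ω) h) m i (j :: l)} =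
      ⋃ n, stays X h m i n ∩ {ω | Follows (skeleton (fun t => X t ω) h) (m + (n + 1)) j l} := by
  ext ω
  simp only [Set.mem_ofPred_eq, Set.mem_iUnion, Set.mem_inter_iff, stays, Follows, skeleton]
  constructor
  · rintro ⟨t, hmt, hc, H⟩
    obtain ⟨n, rfl⟩ := Nat.exists_eq_add_of_lt hmt
    exact ⟨n, fun k hk => hc _ (by omega) (by omega), H⟩
  · rintro ⟨n, hc, H⟩
    refine ⟨m + (n + 1), by omega, fun u h1 h2 => ?_, H⟩
    obtain ⟨k, rfl⟩ := Nat.exists_eq_add_of_le h1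
    exact hc k (by omega)

variable [mΩ : MeasurableSpace Ω] {P : Measure Ω}

lemma past_le (hX : ∀ t, Measurable (X t)) (s : ℝ≥0) : past X s ≤ mΩ :=
  iSup_le fun u => (hX u).comap_le

lemma IsMarkovWith.measure_inter [IsFiniteMeasure P] {p : ℝ → ℕ → ℕ → ℝ} (hM : IsMarkovWith P p X)
    {s t : ℝ≥0} {A : Set Ω} (hA : MeasurableSet[past X s] A) (i j : ℕ) :
    P (A ∩ {ω | X s ω = i} ∩ {ω | X (s + t) ω = j}) =
      P (A ∩ {ω | X s ω = i}) * ENNReal.ofReal (p t i j) := by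
  have h := congrArg ENNReal.ofReal (hM s t i j A hA)
  rwa [ENNReal.ofReal_mul measureReal_nonneg, ofReal_measureReal, ofReal_measureReal] at h

/-- One step of the skeleton after a sojourn in `i`. -/
lemma IsMarkovWith.measure_stays_inter [IsFiniteMeasure P] {p : ℝ → ℕ → ℕ → ℝ}
    (hM : IsMarkovWith P p X) {h : ℝ≥0} {m i n : ℕ} (j : ℕ) {A : Set Ω}
    (hA : MeasurableSet[past X (m * h)] A) :
    P (A ∩ stays X h m i n ∩ {ω | X ((m + (n + 1) : ℕ) * h) ω = j}) =
      P (A ∩ stays X h m i n) * ENNReal.ofReal (p h i j) := by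
  have hA' : MeasurableSet[past X ((m + n : ℕ) * h)] (A ∩ stays X h m i n) :=
    MeasurableSet.inter (past_mono (by gcongr; omega) _ hA) (measurableSet_past_stays h m i n)
  have hsub : A ∩ stays X h m i n ∩ {ω | X ((m + n : ℕ) * h) ω = i} = A ∩ stays X h m i n :=
    Set.inter_eq_left.2 fun ω hω => hω.2 n le_rfl
  have := hM.measure_inter (t := h) hA' i j
  rw [hsub, show ((m + n : ℕ) : ℝ≥0) * h + h = (m + (n + 1) : ℕ) * h by push_cast; ring] at this
  exact this

lemma IsMarkovWith.measure_inter_stays [IsFiniteMeasure P] {p : ℝ → ℕ → ℕ → ℝ}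
    (hM : IsMarkovWith P p X) {h : ℝ≥0} {m i : ℕ} {A : Set Ω}
    (hA : MeasurableSet[past X (m * h)] A) (n : ℕ) :
    P (A ∩ stays X h m i n) = P (A ∩ {ω | X (m * h) ω = i}) * ENNReal.ofReal (p h i i) ^ n := by
  induction n with
  | zero => rw [stays_zero, pow_zero, mul_one]
  | succ n ih =>
    rw [stays_succ, ← Set.inter_assoc, hM.measure_stays_inter i hA, ih, pow_succ, mul_assoc]

lemma measurableSet_follows_skeleton (hX : ∀ t, Measurable (X t)) (h : ℝ≥0) :
    ∀ (l : List ℕ) (m i : ℕ), MeasurableSet {ω | Follows (skeleton (fun t => X t ω) h) m i l}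
  | [], m, i => hX (m * h) (measurableSet_singleton i)
  | j :: l, m, i => by
    rw [follows_skeleton_cons]
    exact MeasurableSet.iUnion fun n => (past_le hX _ _ (measurableSet_past_stays h m i n)).inter
      (measurableSet_follows_skeleton hX h l _ j)

/-- The skeleton of mesh `h` is a discrete time Markov chain, and its successive distinct states
form a Markov chain with transition weights `p_{ij}(h) / (1 - p_{ii}(h))`, the sum over the length
of the sojourn in `i`. In `ℝ≥0∞` the geometric series needs no case distinction at
`p_{ii}(h) = 1`. -/
lemma IsMarkovWith.measure_follows_skeleton [IsFiniteMeasure P] {p : ℝ → ℕ → ℕ → ℝ}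
    (hM : IsMarkovWith P p X) (hX : ∀ t, Measurable (X t)) (h : ℝ≥0) :
    ∀ (l : List ℕ) (m i : ℕ) (A : Set Ω), IsHit i l → MeasurableSet[past X (m * h)] A →
      P (A ∩ {ω | Follows (skeleton (fun t => X t ω) h) m i l}) =
        P (A ∩ {ω | X (m * h) ω = i}) * wordWeight (fun i j =>
          (1 - ENNReal.ofReal (p h i i))⁻¹ * ENNReal.ofReal (p h i j)) i l
  | [], m, i, A, _, _ => by
    rw [wordWeight, mul_one]
    rfl
  | j :: l, m, i, A, hl, hA => by
    have hstep : ∀ n, P (A ∩ (stays X h m i n ∩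
        {ω | Follows (skeleton (fun t => X t ω) h) (m + (n + 1)) j l})) =
        P (A ∩ {ω | X (m * h) ω = i}) * ENNReal.ofReal (p h i i) ^ n *
          (ENNReal.ofReal (p h i j) * wordWeight (fun i j =>
            (1 - ENNReal.ofReal (p h i i))⁻¹ * ENNReal.ofReal (p h i j)) j l) := by
      intro n
      have hA' : MeasurableSet[past X ((m + (n + 1) : ℕ) * h)] (A ∩ stays X h m i n) :=
        MeasurableSet.inter (past_mono (by gcongr; omega) _ hA)
          (past_mono (by gcongr; omega) _ (measurableSet_past_stays h m i n))
      rw [← Set.inter_assoc, hM.measure_follows_skeleton hX h l _ j _ hl.2.2 hA',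
        hM.measure_stays_inter j hA, hM.measure_inter_stays hA, mul_assoc]
    rw [follows_skeleton_cons, Set.inter_iUnion, measure_iUnion]
    · simp_rw [hstep]
      rw [ENNReal.tsum_mul_right, ENNReal.tsum_mul_left, ENNReal.tsum_geometric, wordWeight]
      ring
    · -- The length of the sojourn in `i` is determined by the path since `j ≠ i`.
      have key : ∀ n n', n < n' → Disjoint
          (A ∩ (stays X h m i n ∩
            {ω | Follows (skeleton (fun t => X t ω) h) (m + (n + 1)) j l}))
          (A ∩ (stays X h m i n' ∩
            {ω | Follows (skeleton (fun t => X t ω) h) (m + (n' + 1)) j l})) := by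
        intro n n' hn
        rw [Set.disjoint_left]
        rintro ω ⟨-, -, h1⟩ ⟨-, h2, -⟩
        exact hl.2.1 ((h2 (n + 1) hn).symm.trans h1.eq)
      intro n n' hn
      rcases hn.lt_or_gt with hn | hn
      · exact key n n' hn
      · exact (key n' n hn).symm
    · intro n
      exact (past_le hX _ _ hA).inter ((past_le hX _ _ (measurableSet_past_stays h m i n)).inter
        (measurableSet_follows_skeleton hX h l _ j))

end Markov

/-- The embedded jump weights `q_{ij} / (-q_{ii})` are the limits of the jump weights of the
skeletons. -/
lemma tendsto_jump_weight {p : ℝ → ℕ → ℕ → ℝ} {Q : ℕ → ℕ → ℝ} (hp : IsTransitionFunction p)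
    (hQ : HasGenerator p Q) {i j : ℕ} (hij : i ≠ j) (hi : Q i i < 0) :
    Tendsto (fun h : ℝ≥0 => (1 - ENNReal.ofReal (p h i i))⁻¹ * ENNReal.ofReal (p h i j))
      (𝓝[>] 0) (𝓝 (ENNReal.ofReal (Q i j / -Q i i))) := by
  have hmap : Tendsto (fun h : ℝ≥0 => (h : ℝ)) (𝓝[>] 0) (𝓝[>] 0) := by
    refine tendsto_nhdsWithin_iff.2 ⟨?_, ?_⟩
    · exact (NNReal.continuous_coe.tendsto 0).mono_left nhdsWithin_le_nhds
    · filter_upwards [self_mem_nhdsWithin] with h (h0 : 0 < h) using NNReal.coe_pos.2 h0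
  have hd : ∀ j, Tendsto (fun h : ℝ => h⁻¹ * (p h i j - p 0 i j)) (𝓝[>] 0) (𝓝 (Q i j)) := by
    intro j
    have := (hasDerivWithinAt_iff_tendsto_slope.1 (hQ i j))
    rw [Set.Ici_sdiff_left] at this
    refine this.congr fun h => ?_
    rw [slope_def_field, sub_zero, div_eq_inv_mul]
  have hoff := hd j
  have hdiag := (hd i).neg
  simp only [hp.zero, if_neg hij, sub_zero] at hoff
  simp only [hp.zero, if_true] at hdiag
  have hlim := ((hoff.div hdiag (by linarith : -Q i i ≠ 0)).comp hmap)
  refine ((ENNReal.continuous_ofReal.tendsto _).comp hlim).congr' ?_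
  have hpos : ∀ᶠ h : ℝ≥0 in 𝓝[>] 0, 0 < -((h : ℝ)⁻¹ * (p h i i - 1)) :=
    (hdiag.comp hmap).eventually_const_lt (by linarith)
  filter_upwards [hpos, self_mem_nhdsWithin] with h h1 (h0 : 0 < h)
  have h0' : (0 : ℝ) < h := h0
  have h2 : 0 < 1 - p h i i := by
    have : -((h : ℝ)⁻¹ * (p h i i - 1)) = (h : ℝ)⁻¹ * (1 - p h i i) := by ring
    rw [this] at h1
    exact pos_of_mul_pos_right h1 (inv_nonneg.2 h0'.le)
  rw [← ENNReal.ofReal_one, ← ENNReal.ofReal_sub _ (hp.nonneg h h0'.le i i),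
    ← ENNReal.ofReal_inv_of_pos h2, ← ENNReal.ofReal_mul (inv_nonneg.2 h2.le)]
  simp only [Function.comp_apply, Pi.div_apply]
  congr 1
  have h3 : p h i i - 1 ≠ 0 := by linarith
  have h4 : 1 - p h i i ≠ 0 := h2.ne'
  rw [← neg_sub 1 (p (↑h) i i)]
  field_simp

lemma tendsto_wordWeight {p : ℝ → ℕ → ℕ → ℝ} {Q : ℕ → ℕ → ℝ} (hp : IsTransitionFunction p)
    (hQ : HasGenerator p Q) (hneg : ∀ i, i ≠ 0 → Q i i < 0) :
    ∀ (l : List ℕ) (i : ℕ), IsHit i l → Tendsto (fun h : ℝ≥0 => wordWeight (fun i j =>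
        (1 - ENNReal.ofReal (p h i i))⁻¹ * ENNReal.ofReal (p h i j)) i l) (𝓝[>] 0)
      (𝓝 (wordWeight (fun i j => ENNReal.ofReal (Q i j / -Q i i)) i l)) ∧
      wordWeight (fun i j => ENNReal.ofReal (Q i j / -Q i i)) i l ≠ ∞
  | [], i, _ => ⟨tendsto_const_nhds, ENNReal.one_ne_top⟩
  | j :: l, i, hl => by
    obtain ⟨h1, h2⟩ := tendsto_wordWeight hp hQ hneg l j hl.2.2
    refine ⟨?_, ENNReal.mul_ne_top ENNReal.ofReal_ne_top h2⟩
    exact ENNReal.Tendsto.mul (tendsto_jump_weight hp hQ hl.2.1 (hneg i hl.1)) (Or.inr h2) h1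
      (Or.inr ENNReal.ofReal_ne_top)

/-- A regular chain started at `i` follows a word with the probability that the embedded jump
chain gives to it. -/
lemma IsRegularChain.measure_follows {Ω : Type*} [MeasurableSpace Ω] {P : Measure Ω}
    [IsProbabilityMeasure P] {Q : ℕ → ℕ → ℝ} {X : ℝ≥0 → Ω → ℕ} (hX : IsRegularChain P Q X)
    (hneg : ∀ i, i ≠ 0 → Q i i < 0) {i : ℕ} (h0 : ∀ᵐ ω ∂P, X 0 ω = i) {l : List ℕ}
    (hl : IsHit i l) :
    NullMeasurableSet {ω | Follows (fun t => X t ω) 0 i l} P ∧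
      P {ω | Follows (fun t => X t ω) 0 i l} =
        wordWeight (fun i j => ENNReal.ofReal (Q i j / -Q i i)) i l := by
  obtain ⟨p, hp, hQ, -, hM⟩ := hX.markov
  have : (𝓝[>] (0 : ℝ≥0)).NeBot := nhdsGT_neBot_of_exists_gt ⟨1, zero_lt_one⟩
  set A : ℝ≥0 → Set Ω := fun h => {ω | Follows (skeleton (fun t => X t ω) h) 0 i l} with hA
  have hAm : ∀ h, MeasurableSet (A h) := fun h =>
    measurableSet_follows_skeleton hX.measurable h l 0 i
  have hlim : ∀ᵐ ω ∂P, ∀ᶠ h in 𝓝[>] (0 : ℝ≥0),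
      ω ∈ A h ↔ ω ∈ {ω | Follows (fun t => X t ω) 0 i l} := by
    filter_upwards [hX.rightContinuous] with ω hω
    have := eventually_follows_skeleton_iff hω l i 0 hl
    simp only [zero_div, Nat.ceil_zero] at this
    exact this
  have hnull : NullMeasurableSet {ω | Follows (fun t => X t ω) 0 i l} P :=
    nullMeasurableSet_of_tendsto_indicator _ (fun h => (hAm h).nullMeasurableSet) hlim
  refine ⟨hnull, ?_⟩
  obtain ⟨B, hBm, hB⟩ := hnull
  have hlim' : ∀ᵐ ω ∂P, ∀ᶠ h in 𝓝[>] (0 : ℝ≥0), ω ∈ A h ↔ ω ∈ B := by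
    filter_upwards [hlim, hB.mem_iff] with ω h1 h2
    filter_upwards [h1] with h h1
    rw [h1, h2]
  have h1 := tendsto_measure_of_ae_tendsto_indicator_of_isFiniteMeasure _ hBm hAm hlim'
  rw [← measure_congr hB] at h1
  refine tendsto_nhds_unique (h1.congr fun h => ?_) (tendsto_wordWeight hp hQ hneg l i hl).1
  have h2 := hM.measure_follows_skeleton hX.measurable h l 0 i Set.univ hl MeasurableSet.univ
  simp only [Set.univ_inter, Nat.cast_zero, zero_mul] at h2
  rw [show P {ω | X 0 ω = i} = 1 from (prob_compl_eq_zero_iff₀ ?_).1 h0, one_mul] at h2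
  · exact h2
  · exact (hX.measurable 0 (measurableSet_singleton i)).nullMeasurableSet

/-! ### Summation over words -/

/-- The transition weights of the jump chain away from `0`: a jump from `i` to `j = i - 1 + m` has
weight `a m`. -/
noncomputable def jumpKernel (a : ℕ → ℝ≥0∞) (i j : ℕ) : ℝ≥0∞ :=
  if i ≤ j + 1 then a (j + 1 - i) else 0

open Classical in
/-- The probability that the jump chain started at `i` hits `0` after exactly `k` deaths, as a sum
over all words. -/
noncomputable def wordSum (a : ℕ → ℝ≥0∞) (i k : ℕ) : ℝ≥0∞ :=
  ∑' l, if IsHit i l ∧ downs i l = k then wordWeight (jumpKernel a) i l else 0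

lemma tsum_list (f : List ℕ → ℝ≥0∞) : ∑' l, f l = f [] + ∑' j, ∑' l, f (j :: l) := by
  have hinj : Function.Injective fun q : ℕ × List ℕ => q.1 :: q.2 := by
    rintro ⟨j, l⟩ ⟨j', l'⟩ h
    simpa using h
  have hcons : ∑' l, ({[]}ᶜ : Set (List ℕ)).indicator f l =
      ∑' q : ℕ × List ℕ, f (q.1 :: q.2) := by
    rw [← hinj.tsum_eq (f := ({[]}ᶜ : Set (List ℕ)).indicator f)]
    · refine tsum_congr fun q => Set.indicator_of_mem ?_ f
      exact List.cons_ne_nil _ _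
    · intro l hl
      cases l with
      | nil => exact absurd (Set.indicator_of_notMem (by simp) f) hl
      | cons j l => exact ⟨(j, l), rfl⟩
  have hnil : ∑' l, ({[]} : Set (List ℕ)).indicator f l = f [] := by
    rw [← tsum_subtype, tsum_singleton]
  rw [← ENNReal.tsum_prod (f := fun j l => f (j :: l)), ← hcons, ← hnil, ← ENNReal.tsum_add]
  exact tsum_congr fun l => (Set.indicator_self_add_compl_apply _ f l).symm

lemma wordSum_zero (a : ℕ → ℝ≥0∞) (k : ℕ) : wordSum a 0 k = if k = 0 then 1 else 0 := by
  rw [wordSum, tsum_list]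
  simp [IsHit, downs, wordWeight, eq_comm]

open Classical in
/-- The first step decomposition of `wordSum`. -/
lemma wordSum_succ (a : ℕ → ℝ≥0∞) (n k : ℕ) :
    wordSum a (n + 1) k = a 0 * (if k = 0 then 0 else wordSum a n (k - 1)) +
      ∑' m, a (m + 2) * wordSum a (n + m + 2) k := by
  have hstep : ∀ j, (∑' l, if IsHit (n + 1) (j :: l) ∧ downs (n + 1) (j :: l) = k then
      wordWeight (jumpKernel a) (n + 1) (j :: l) else 0) =
      if j = n + 1 then 0 else jumpKernel a (n + 1) j *
        if j = n then (if k = 0 then 0 else wordSum a n (k - 1)) else wordSum a j k := by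
    intro j
    split_ifs with h1 h2 h3
    · simp [IsHit, h1]
    · rw [mul_zero, ENNReal.tsum_eq_zero]
      intro l
      rw [if_neg]
      rintro ⟨-, h⟩
      rw [downs, if_pos (by omega)] at h
      omega
    · subst h2
      rw [wordSum, ← ENNReal.tsum_mul_left]
      refine tsum_congr fun l => ?_
      rw [mul_ite, mul_zero]
      refine if_congr ?_ rfl rfl
      rw [IsHit, downs, if_pos rfl]
      have : 1 + downs j l = k ↔ downs j l = k - 1 := by omega
      simp [this]
    · rw [wordSum, ← ENNReal.tsum_mul_left]
      refine tsum_congr fun l => ?_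
      rw [mul_ite, mul_zero]
      refine if_congr ?_ rfl rfl
      rw [IsHit, downs, if_neg (by omega), zero_add]
      have : n + 1 ≠ j := Ne.symm h1
      simp [this]
  rw [wordSum, tsum_list, tsum_congr hstep, if_neg (by simp [IsHit]), zero_add,
    ← (add_right_injective n).tsum_eq, tsum_eq_zero_add' ENNReal.summable,
    tsum_eq_zero_add' ENNReal.summable]
  · have h1 : jumpKernel a (n + 1) n = a 0 := by simp [jumpKernel]
    have h2 : ∀ m, jumpKernel a (n + 1) (n + (m + 1 + 1)) = a (m + 2) := fun m => by
      rw [jumpKernel, if_pos (by omega)]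
      congr 1
      omega
    simp [h1, h2, add_assoc]
  · intro j hj
    by_contra hlt
    have hjn : j < n := by
      by_contra! h
      exact hlt ⟨j - n, Nat.add_sub_cancel' h⟩
    refine hj ?_
    beta_reduce
    rw [if_neg (show ¬j = n + 1 by omega), jumpKernel,
      if_neg (show ¬n + 1 ≤ j + 1 by omega), zero_mul]

lemma wordWeight_eq_zero (a : ℕ → ℝ≥0∞) : ∀ (l : List ℕ) (i : ℕ), IsHit i l → downs i l < i →
    wordWeight (jumpKernel a) i l = 0
  | [], i, h, h' => by simp_all [IsHit, downs]
  | j :: l, i, ⟨_, hij, hl⟩, h' => by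
    rw [downs] at h'
    by_cases hle : i ≤ j + 1
    · rw [wordWeight, wordWeight_eq_zero a l j hl (by split_ifs at h' <;> omega), mul_zero]
    · rw [wordWeight, jumpKernel, if_neg hle, zero_mul]

/-- At least `i` deaths are needed to get from `i` to `0`. -/
lemma wordSum_eq_zero_of_lt (a : ℕ → ℝ≥0∞) {i k : ℕ} (h : k < i) : wordSum a i k = 0 := by
  rw [wordSum, ENNReal.tsum_eq_zero]
  intro l
  split_ifs with hl
  · exact wordWeight_eq_zero a l i hl.1 (hl.2 ▸ h)
  · rfl

open PowerSeries in
/-- The powers of the generating function of `r` satisfy the first step decomposition. -/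
lemma coeff_pow_succ_of_recursion {a r : ℕ → ℝ≥0∞}
    (hr : ∀ k, r k = (if k = 1 then a 0 else 0) + ∑' m, a (m + 2) * coeff k (mk r ^ (m + 2)))
    (n k : ℕ) : coeff k (mk r ^ (n + 1)) =
      a 0 * (if k = 0 then 0 else coeff (k - 1) (mk r ^ n)) +
        ∑' m, a (m + 2) * coeff k (mk r ^ (n + m + 2)) := by
  have h1 : ∀ q : ℕ × ℕ, coeff q.1 (mk r) * coeff q.2 (mk r ^ n) =
      (if q.1 = 1 then a 0 else 0) * coeff q.2 (mk r ^ n) +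
        ∑' m, a (m + 2) * (coeff q.1 (mk r ^ (m + 2)) * coeff q.2 (mk r ^ n)) := by
    intro q
    rw [coeff_mk, hr q.1, add_mul, ← ENNReal.tsum_mul_right]
    simp_rw [mul_assoc]
  have h2 : ∀ m, mk r ^ (n + m + 2) = mk r ^ (m + 2) * mk r ^ n := fun m => by
    rw [← pow_add]
    congr 1
    omega
  rw [pow_succ', coeff_mul, Finset.sum_congr rfl fun q _ => h1 q, Finset.sum_add_distrib]
  congr 1
  · cases k with
    | zero => simp
    | succ k =>
      rw [Finset.sum_eq_single (1, k)]
      · simp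
      · rintro ⟨q1, q2⟩ hq hne
        rw [if_neg, zero_mul]
        rintro rfl
        refine hne ?_
        rw [Finset.HasAntidiagonal.mem_antidiagonal] at hq
        ext
        · rfl
        · show q2 = k
          simp only at hq
          omega
      · intro h
        exact absurd (Finset.HasAntidiagonal.mem_antidiagonal.2 (add_comm 1 k)) h
  · rw [← Summable.tsum_finsetSum fun _ _ => ENNReal.summable]
    refine tsum_congr fun m => ?_
    rw [h2, coeff_mul, Finset.mul_sum]

open PowerSeries in
lemma coeff_pow_eq_zero_of_lt {R : Type*} [CommSemiring R] {r : ℕ → R} (h0 : r 0 = 0) {i k : ℕ}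
    (h : k < i) : coeff k (mk r ^ i) = 0 := by
  refine X_pow_dvd_iff.1 (pow_dvd_pow_of_dvd (X_dvd_iff.2 ?_) i) k h
  rw [← coeff_zero_eq_constantCoeff_apply, coeff_mk, h0]

open PowerSeries in
/-- The probability of `k` deaths before the first visit to `0` from `i` is the `i`-th convolution
power of `r`. Both sides solve the system of first step equations, which has at most one solution
vanishing for `k < i`: an equation for `(i, k)` only involves `k - 1` and states above `i`. -/
lemma wordSum_eq_coeff {a r : ℕ → ℝ≥0∞} (h0 : r 0 = 0)
    (hr : ∀ k, r k = (if k = 1 then a 0 else 0) + ∑' m, a (m + 2) * coeff k (mk r ^ (m + 2)))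
    (i k : ℕ) : wordSum a i k = coeff k (mk r ^ i) := by
  induction k using Nat.strong_induction_on generalizing i with
  | _ k ihk =>
    suffices H : ∀ d i, k < i + d → wordSum a i k = coeff k (mk r ^ i) from H (k + 1) i (by omega)
    intro d
    induction d with
    | zero =>
      intro i hi
      rw [wordSum_eq_zero_of_lt a (show k < i from hi),
        coeff_pow_eq_zero_of_lt h0 (show k < i from hi)]
    | succ d ihd =>
      intro i hi
      cases i with
      | zero => rw [wordSum_zero, pow_zero, coeff_one]
      | succ n =>
        rw [wordSum_succ, coeff_pow_succ_of_recursion hr]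
        congr 1
        · split_ifs with h
          · rfl
          · rw [ihk (k - 1) (by omega)]
        · refine tsum_congr fun m => ?_
          rw [ihd _ (by omega)]

/-! ### The recursion and the minimal root -/

section Convolution

open PowerSeries

lemma coeff_mk_pow {R : Type*} [CommSemiring R] (f : ℕ → R) (j l : ℕ) :
    coeff l (mk f ^ j) =
      ∑ k ∈ Finset.piAntidiag (Finset.univ : Finset (Fin j)) l, ∏ i, f (k i) := by
  have h : mk f ^ j = ∏ _i : Fin j, mk f := by simp
  rw [h, coeff_prod]
  refine Finset.sum_nbij (fun k => ⇑k) ?_ ?_ ?_ ?_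
  · intro k hk
    rw [Finset.mem_finsuppAntidiag] at hk
    simpa using hk.1
  · exact DFunLike.coe_injective.injOn
  · intro k hk
    have hk := (Finset.mem_piAntidiag.1 (Finset.mem_coe.1 hk)).1
    refine ⟨Finsupp.equivFunOnFinite.symm k, ?_, rfl⟩
    rw [Finset.mem_coe, Finset.mem_finsuppAntidiag]
    exact ⟨hk, Finset.subset_univ _⟩
  · intro k _
    simp

lemma convolution_eq_coeff (f : ℕ → ℝ) (j l : ℕ) : convolution f j l = coeff l (mk f ^ j) :=
  (coeff_mk_pow f j l).symm

lemma ofReal_convolution {f : ℕ → ℝ} (hf : ∀ k, 0 ≤ f k) (j l : ℕ) :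
    ENNReal.ofReal (convolution f j l) = coeff l (mk (fun k => ENNReal.ofReal (f k)) ^ j) := by
  rw [coeff_mk_pow, convolution, ENNReal.ofReal_sum_of_nonneg]
  · exact Finset.sum_congr rfl fun k _ => ENNReal.ofReal_prod_of_nonneg fun i _ => hf _
  · exact fun k _ => Finset.prod_nonneg fun i _ => hf _

/-- If `f 0 = g 0 = 0`, the convolutions of order at least two at `k + 1` only involve the values
up to `k`. -/
lemma coeff_pow_congr {R : Type*} [CommSemiring R] {f g : ℕ → R} (hf : f 0 = 0) (hg : g 0 = 0)
    {k : ℕ} (h : ∀ m ≤ k, f m = g m) {j : ℕ} (hj : 2 ≤ j) :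
    coeff (k + 1) (mk f ^ j) = coeff (k + 1) (mk g ^ j) := by
  rw [coeff_mk_pow, coeff_mk_pow]
  refine Finset.sum_congr rfl fun n hn => ?_
  by_cases h0 : ∃ i, n i = 0
  · obtain ⟨i, hi⟩ := h0
    rw [Finset.prod_eq_zero (Finset.mem_univ i) (by rw [hi, hf]),
      Finset.prod_eq_zero (Finset.mem_univ i) (by rw [hi, hg])]
  · push Not at h0
    refine Finset.prod_congr rfl fun i _ => h _ ?_
    have : Nontrivial (Fin j) := Fin.nontrivial_iff_two_le.2 hj
    obtain ⟨i', hi'⟩ := exists_ne i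
    have h1 : ∑ i, n i = k + 1 := (Finset.mem_piAntidiag.1 hn).1
    have h2 : n i + n i' ≤ ∑ i, n i := by
      rw [← Finset.sum_pair hi'.symm]
      exact Finset.sum_le_sum_of_subset (Finset.subset_univ _)
    have h3 := h0 i'
    omega

lemma tsum_coeff_mul (F G : PowerSeries ℝ≥0∞) :
    ∑' k, coeff k (F * G) = (∑' k, coeff k F) * ∑' k, coeff k G := by
  rw [← ENNReal.tsum_mul_right]
  simp_rw [← ENNReal.tsum_mul_left]
  rw [← ENNReal.tsum_prod (f := fun m n => coeff m F * coeff n G),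
    ← (Finset.HasAntidiagonal.sigmaAntidiagonalEquivProd (A := ℕ)).tsum_eq, ENNReal.tsum_sigma']
  refine tsum_congr fun k => ?_
  rw [coeff_mul, tsum_fintype, ← Finset.sum_coe_sort]
  rfl

lemma tsum_coeff_mk_pow (f : ℕ → ℝ≥0∞) (j : ℕ) : ∑' k, coeff k (mk f ^ j) = (∑' k, f k) ^ j := by
  induction j with
  | zero => simp [coeff_one]
  | succ j ih =>
    rw [pow_succ, tsum_coeff_mul, ih, pow_succ]
    simp

end Convolution

section DeathSequence

variable {b : ℕ → ℝ}

/-- The right-hand sides of the recursion for the death sequence. -/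
noncomputable def deathStep (b f : ℕ → ℝ) : ℕ → ℝ
  | 0 => 0
  | 1 => -(b 1)⁻¹ * b 0
  | k + 2 => -(b 1)⁻¹ * ∑ j ∈ Finset.Icc 2 (k + 2), b j * convolution f j (k + 2)

lemma isDeathSequence_iff (r : ℕ → ℝ) : IsDeathSequence b r ↔ deathStep b r = r := by
  constructor
  · intro h
    funext k
    match k with
    | 0 => exact h.zero.symm
    | 1 => exact h.one.symm
    | k + 2 => exact (h.succ (k + 1) (by omega)).symm
  · intro h
    refine ⟨(congrFun h 0).symm, (congrFun h 1).symm, fun k hk => ?_⟩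
    obtain ⟨k, rfl⟩ := Nat.exists_eq_add_of_le' hk
    exact (congrFun h (k + 2)).symm

lemma deathStep_congr {f g : ℕ → ℝ} (hf : f 0 = 0) (hg : g 0 = 0) {n : ℕ}
    (h : ∀ m ≤ n, f m = g m) : ∀ m ≤ n + 1, deathStep b f m = deathStep b g m
  | 0, _ => rfl
  | 1, _ => rfl
  | k + 2, hk => by
    rw [deathStep, deathStep]
    congr 1
    refine Finset.sum_congr rfl fun j hj => ?_
    rw [convolution_eq_coeff, convolution_eq_coeff,
      coeff_pow_congr hf hg (fun m hm => h m (by omega)) (Finset.mem_Icc.1 hj).1]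

lemma IsDeathSequence.unique {r r' : ℕ → ℝ} (hr : IsDeathSequence b r)
    (hr' : IsDeathSequence b r') : r = r' := by
  have H : ∀ n, ∀ m ≤ n, r m = r' m := by
    intro n
    induction n with
    | zero =>
      intro m hm
      rw [Nat.le_zero.1 hm, hr.zero, hr'.zero]
    | succ n ih =>
      intro m hm
      rw [← (isDeathSequence_iff r).1 hr, ← (isDeathSequence_iff r').1 hr']
      exact deathStep_congr hr.zero hr'.zero ih m hm
  exact funext fun m => H m m le_rfl

/-- The death sequence is the pointwise stationary limit of the iterates of `deathStep`. -/
lemma exists_isDeathSequence (hb : IsRateSequence b) :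
    ∃ r, IsDeathSequence b r ∧ ∀ k, 0 ≤ r k := by
  set f : ℕ → ℕ → ℝ := fun n => (deathStep b)^[n] 0 with hf
  have hsucc : ∀ n, f (n + 1) = deathStep b (f n) := fun n =>
    Function.iterate_succ_apply' _ _ _
  have h0 : ∀ n, f n 0 = 0 := by
    rintro (_ | n)
    · rfl
    · rw [hsucc]
      rfl
  have hpos : ∀ n k, 0 ≤ f n k := by
    have hb1 : 0 ≤ -(b 1)⁻¹ := by
      rw [neg_inv]
      exact inv_nonneg.2 hb.neg_one_pos.le
    intro n
    induction n with
    | zero => exact fun k => le_rfl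
    | succ n ih =>
      rw [hsucc]
      intro k
      match k with
      | 0 => exact le_rfl
      | 1 => exact mul_nonneg hb1 (hb.nonneg 0 (by omega))
      | k + 2 =>
        refine mul_nonneg hb1 (Finset.sum_nonneg fun j hj => ?_)
        have hj2 := (Finset.mem_Icc.1 hj).1
        exact mul_nonneg (hb.nonneg j (by omega))
          (Finset.sum_nonneg fun m _ => Finset.prod_nonneg fun i _ => ih _)
  have hagree : ∀ n, ∀ m ≤ n, f (n + 1) m = f n m := by
    intro n
    induction n with
    | zero =>
      intro m hm
      rw [Nat.le_zero.1 hm, h0, h0]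
    | succ n ih =>
      intro m hm
      rw [hsucc (n + 1), hsucc n]
      exact deathStep_congr (hsucc n ▸ h0 (n + 1)) (h0 n) (fun m hm => hsucc n ▸ ih m hm) m hm
  have hstat : ∀ m n, m ≤ n → f n m = f m m := by
    intro m n hmn
    induction n, hmn using Nat.le_induction with
    | base => rfl
    | succ n hmn ih => rw [hagree n m hmn, ih]
  refine ⟨fun m => f m m, (isDeathSequence_iff _).2 (funext fun m => ?_), fun k => hpos k k⟩
  rw [← hagree m m le_rfl, hsucc]
  exact deathStep_congr (f := fun m => f m m) (h0 0) (h0 m) (fun k hk => (hstat k m hk).symm) m (by omega)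

lemma IsDeathSequence.nonneg (hb : IsRateSequence b) {r : ℕ → ℝ} (hr : IsDeathSequence b r)
    (k : ℕ) : 0 ≤ r k := by
  obtain ⟨r', hr', h⟩ := exists_isDeathSequence hb
  rw [hr.unique hr']
  exact h k

/-- The jump law of the embedded chain: `jumpLaw b m` is the probability of a jump of size
`m - 1`. At `m = 1` the value is `0` since `-1` is truncated. -/
noncomputable def jumpLaw (b : ℕ → ℝ) (m : ℕ) : ℝ≥0∞ := ENNReal.ofReal (b m / -b 1)

open PowerSeries in
lemma IsDeathSequence.recursion (hb : IsRateSequence b) {r : ℕ → ℝ} (hr : IsDeathSequence b r)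
    (k : ℕ) : ENNReal.ofReal (r k) = (if k = 1 then jumpLaw b 0 else 0) +
      ∑' m, jumpLaw b (m + 2) * coeff k (PowerSeries.mk (fun k => ENNReal.ofReal (r k)) ^ (m + 2)) := by
  have h0 : ENNReal.ofReal (r 0) = 0 := by rw [hr.zero, ENNReal.ofReal_zero]
  have hz : ∀ k m, k < m + 2 →
      jumpLaw b (m + 2) * coeff k (PowerSeries.mk (fun k => ENNReal.ofReal (r k)) ^ (m + 2)) = 0 :=
    fun k m hm => by
      rw [coeff_pow_eq_zero_of_lt (r := fun k => ENNReal.ofReal (r k)) h0 hm, mul_zero]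
  match k with
  | 0 =>
    rw [h0, if_neg (by omega), zero_add, eq_comm, ENNReal.tsum_eq_zero]
    exact fun m => hz 0 m (by omega)
  | 1 =>
    rw [if_pos rfl, ENNReal.tsum_eq_zero.2 fun m => hz 1 m (by omega), add_zero, hr.one, jumpLaw,
      div_eq_inv_mul, neg_inv]
  | k + 2 =>
    have hIcc : Finset.Icc 2 (k + 2) = Finset.Ico 2 (k + 3) := rfl
    rw [if_neg (by omega), zero_add, tsum_eq_sum (s := Finset.range (k + 1)), hr.succ (k + 1)
      (by omega), Finset.mul_sum, hIcc, Finset.sum_Ico_eq_sum_range,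
      ENNReal.ofReal_sum_of_nonneg]
    · refine Finset.sum_congr rfl fun m _ => ?_
      rw [← ofReal_convolution (hr.nonneg hb), jumpLaw, add_comm 2 m, ← ENNReal.ofReal_mul]
      · congr 1
        rw [div_eq_inv_mul, neg_inv, mul_assoc]
      · exact div_nonneg (hb.nonneg _ (by omega)) hb.neg_one_pos.le
    · intro m _
      refine mul_nonneg ?_ (mul_nonneg (hb.nonneg _ (by omega))
        (Finset.sum_nonneg fun m _ => Finset.prod_nonneg fun i _ => hr.nonneg hb _))
      rw [neg_inv]
      exact inv_nonneg.2 hb.neg_one_pos.le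
    · intro m hm
      refine hz _ m ?_
      rw [Finset.mem_range] at hm
      omega

open PowerSeries in
/-- The total mass of a solution of the recursion is a fixed point of the generating function of
the offspring law. -/
lemma tsum_eq_of_recursion {a r : ℕ → ℝ≥0∞}
    (hr : ∀ k, r k = (if k = 1 then a 0 else 0) + ∑' m, a (m + 2) * coeff k (mk r ^ (m + 2))) :
    ∑' k, r k = a 0 + ∑' m, a (m + 2) * (∑' k, r k) ^ (m + 2) := by
  conv_lhs => rw [tsum_congr hr]
  rw [ENNReal.tsum_add, tsum_ite_eq, ENNReal.tsum_comm]
  congr 1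
  refine tsum_congr fun m => ?_
  rw [ENNReal.tsum_mul_left, tsum_coeff_mk_pow]

open PowerSeries in
/-- The total mass of the solution of the recursion is at most any fixed point. The truncation of
the solution at `n + 1` is bounded by the image of its truncation at `n`. -/
lemma tsum_le_of_recursion {a r : ℕ → ℝ≥0∞} (h0 : r 0 = 0)
    (hr : ∀ k, r k = (if k = 1 then a 0 else 0) + ∑' m, a (m + 2) * coeff k (mk r ^ (m + 2)))
    {u : ℝ≥0∞} (hu : u = a 0 + ∑' m, a (m + 2) * u ^ (m + 2)) : ∑' k, r k ≤ u := by
  set t : ℕ → ℕ → ℝ≥0∞ := fun n k => if k < n then r k else 0 with ht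
  have hsum : ∀ n, ∑' k, t n k = ∑ k ∈ Finset.range n, r k := by
    intro n
    rw [tsum_eq_sum (s := Finset.range n)]
    · exact Finset.sum_congr rfl fun k hk => if_pos (Finset.mem_range.1 hk)
    · exact fun k hk => if_neg (by simpa using hk)
  have hstep : ∀ n k, t (n + 1) k ≤
      (if k = 1 then a 0 else 0) + ∑' m, a (m + 2) * coeff k (mk (t n) ^ (m + 2)) := by
    intro n k
    by_cases h1 : k < n + 1
    swap
    · rw [show t (n + 1) k = 0 from if_neg h1]
      exact zero_le
    rw [show t (n + 1) k = r k from if_pos h1]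
    cases k with
    | zero =>
      rw [h0]
      exact zero_le
    | succ k =>
      rw [hr (k + 1)]
      refine le_of_eq ?_
      congr 1
      refine tsum_congr fun m => ?_
      rw [coeff_pow_congr (g := t n) h0 (by simp [ht, h0])
        (fun m hm => (if_pos (by omega)).symm) (by omega)]
  refine ENNReal.tsum_le_of_sum_range_le fun n => ?_
  rw [← hsum]
  induction n with
  | zero => simp [ht]
  | succ n ih =>
    calc ∑' k, t (n + 1) k
        ≤ ∑' k, ((if k = 1 then a 0 else 0) +
            ∑' m, a (m + 2) * coeff k (mk (t n) ^ (m + 2))) := ENNReal.tsum_le_tsum (hstep n)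
      _ = a 0 + ∑' m, a (m + 2) * (∑' k, t n k) ^ (m + 2) := by
          rw [ENNReal.tsum_add, tsum_ite_eq, ENNReal.tsum_comm]
          congr 1
          refine tsum_congr fun m => ?_
          rw [ENNReal.tsum_mul_left, tsum_coeff_mk_pow]
      _ ≤ a 0 + ∑' m, a (m + 2) * u ^ (m + 2) := by gcongr
      _ = u := hu.symm

/-- The nonnegative roots of `B` are the finite fixed points of the offspring generating
function. -/
lemma mem_nonnegRoots_iff (hb : IsRateSequence b) {u : ℝ} (hu : 0 ≤ u) :
    u ∈ nonnegRoots b ↔ ENNReal.ofReal u =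
      jumpLaw b 0 + ∑' m, jumpLaw b (m + 2) * ENNReal.ofReal u ^ (m + 2) := by
  have hβ := hb.neg_one_pos
  have hb1 : b 1 ≠ 0 := by linarith
  have ha0 : 0 ≤ b 0 / -b 1 := div_nonneg (hb.nonneg 0 (by omega)) hβ.le
  have hpos : ∀ m, 0 ≤ b (m + 2) / -b 1 * u ^ (m + 2) := fun m =>
    mul_nonneg (div_nonneg (hb.nonneg _ (by omega)) hβ.le) (pow_nonneg hu _)
  have hterm : ∀ m, jumpLaw b (m + 2) * ENNReal.ofReal u ^ (m + 2) =
      ENNReal.ofReal (b (m + 2) / -b 1 * u ^ (m + 2)) := fun m => by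
    rw [jumpLaw, ← ENNReal.ofReal_pow hu,
      ← ENNReal.ofReal_mul (div_nonneg (hb.nonneg _ (by omega)) hβ.le)]
  have hiff : u ∈ nonnegRoots b ↔
      HasSum (fun m => b (m + 2) / -b 1 * u ^ (m + 2)) (u - b 0 / -b 1) := by
    have h1 : (u ∈ nonnegRoots b) ↔ HasSum (fun j => b j * u ^ j) 0 :=
      and_iff_right hu
    rw [h1, ← hasSum_nat_add_iff' 2, ← hasSum_mul_left_iff (a₂ := (-b 1)⁻¹) (by simpa using hb1)]
    have h2 : (-b 1)⁻¹ * (0 - ∑ i ∈ Finset.range 2, b i * u ^ i) = u - b 0 / -b 1 := by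
      simp only [Finset.sum_range_succ, Finset.sum_range_zero]
      field_simp
      ring
    rw [h2]
    refine iff_of_eq (congrArg (HasSum · _) (funext fun m => ?_))
    rw [div_eq_inv_mul, mul_assoc]
  rw [hiff, tsum_congr hterm, jumpLaw]
  constructor
  · intro h
    rw [← ENNReal.ofReal_tsum_of_nonneg hpos h.summable, h.tsum_eq,
      ← ENNReal.ofReal_add ha0 (h.nonneg hpos), add_sub_cancel]
  · intro h
    have hfin : ∑' m, ENNReal.ofReal (b (m + 2) / -b 1 * u ^ (m + 2)) ≠ ∞ := by
      intro h'
      rw [h', add_top] at h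
      exact ENNReal.ofReal_ne_top h
    have hs := ENNReal.hasSum_toReal hfin
    rw [← ENNReal.tsum_toReal_eq fun m => ENNReal.ofReal_ne_top] at hs
    simp only [ENNReal.toReal_ofReal (hpos _)] at hs
    convert hs using 1
    have h' := congrArg ENNReal.toReal h
    rw [ENNReal.toReal_ofReal hu, ENNReal.toReal_add ENNReal.ofReal_ne_top hfin,
      ENNReal.toReal_ofReal ha0] at h'
    linarith

lemma one_mem_nonnegRoots (hb : IsRateSequence b) : (1 : ℝ) ∈ nonnegRoots b := by
  refine ⟨zero_le_one, ?_⟩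
  simp only [one_pow, mul_one]
  have h1 : HasSum (b ∘ ((↑) : ({1} : Set ℕ) → ℕ)) (b 1) := hasSum_singleton 1 b
  have h2 : HasSum (b ∘ ((↑) : (({1} : Set ℕ)ᶜ : Set ℕ) → ℕ)) (-b 1) := hb.hasSum
  simpa using h1.add_compl h2

/-- The total mass of the death sequence is the minimal nonnegative root of `B`. -/
lemma IsDeathSequence.exists_isLeast (hb : IsRateSequence b) {r : ℕ → ℝ}
    (hr : IsDeathSequence b r) : ∃ ρ, IsLeast (nonnegRoots b) ρ ∧ HasSum r ρ := by
  have h0 : ENNReal.ofReal (r 0) = 0 := by rw [hr.zero, ENNReal.ofReal_zero]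
  set R := ∑' k, ENNReal.ofReal (r k) with hR
  have hle : ∀ u ∈ nonnegRoots b, R ≤ ENNReal.ofReal u := fun u hu =>
    tsum_le_of_recursion h0 (hr.recursion hb) ((mem_nonnegRoots_iff hb hu.1).1 hu)
  have hfin : R ≠ ∞ := ne_top_of_le_ne_top ENNReal.ofReal_ne_top (hle 1 (one_mem_nonnegRoots hb))
  refine ⟨R.toReal, ⟨?_, fun u hu => ?_⟩, ?_⟩
  · rw [mem_nonnegRoots_iff hb ENNReal.toReal_nonneg, ENNReal.ofReal_toReal hfin]
    exact tsum_eq_of_recursion (hr.recursion hb)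
  · exact ENNReal.toReal_le_of_le_ofReal hu.1 (hle u hu)
  · have hs := ENNReal.hasSum_toReal hfin
    rw [← ENNReal.tsum_toReal_eq fun m => ENNReal.ofReal_ne_top] at hs
    simpa only [ENNReal.toReal_ofReal (hr.nonneg hb _)] using hs

end DeathSequence

/-! ### The law of the number of deaths -/

lemma wordWeight_congr {κ κ' : ℕ → ℕ → ℝ≥0∞} (h : ∀ i j, i ≠ 0 → i ≠ j → κ i j = κ' i j) :
    ∀ (l : List ℕ) (i : ℕ), IsHit i l → wordWeight κ i l = wordWeight κ' i l
  | [], _, _ => rfl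
  | j :: l, i, hl => by
    rw [wordWeight, wordWeight, h i j hl.1 hl.2.1, wordWeight_congr h l j hl.2.2]

section Regular

variable {Ω : Type*} [MeasurableSpace Ω] {P : Measure Ω} {X : ℝ≥0 → Ω → ℕ}

/-- Almost surely, extinction means that the path follows a finite word with first letter `1`. -/
lemma IsRegularChain.ae_extinction_iff {Q : ℕ → ℕ → ℝ} (hX : IsRegularChain P Q X)
    (h1 : ∀ᵐ ω ∂P, X 0 ω = 1) :
    ∀ᵐ ω ∂P, extinctionTime X ω < ∞ → ∃ l, IsHit 1 l ∧ Follows (fun t => X t ω) 0 1 l := by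
  filter_upwards [h1, hX.rightContinuous, hX.leftLimits] with ω h1 hr hleft hτ
  obtain ⟨t, ht⟩ := iInf_lt_iff.1 hτ
  obtain ⟨ht, -⟩ := iInf_lt_iff.1 ht
  have := exists_follows_of_eq_zero hr hleft (t := t) ht
  rwa [h1] at this

variable [IsProbabilityMeasure P]

/-- The joint law of extinction and the number of deaths. -/
lemma IsRegularChain.measure_totalDeaths {b : ℕ → ℝ} (hb : IsRateSequence b) {r : ℕ → ℝ}
    (hr : IsDeathSequence b r) {Q : ℕ → ℕ → ℝ} (hX : IsRegularChain P Q X)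
    (hneg : ∀ i, i ≠ 0 → Q i i < 0)
    (hQ : ∀ i j, i ≠ 0 → i ≠ j → ENNReal.ofReal (Q i j / -Q i i) = jumpKernel (jumpLaw b) i j)
    (h1 : ∀ᵐ ω ∂P, X 0 ω = 1) (k : ℕ) :
    NullMeasurableSet {ω | extinctionTime X ω < ∞ ∧ totalDeaths X ω = k} P ∧
      P {ω | extinctionTime X ω < ∞ ∧ totalDeaths X ω = k} = ENNReal.ofReal (r k) := by
  classical
  set S : Set (List ℕ) := {l | IsHit 1 l ∧ downs 1 l = k} with hS
  set E : S → Set Ω := fun l => {ω | Follows (fun t => X t ω) 0 1 l.1} with hE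
  have hEm : ∀ l, NullMeasurableSet (E l) P := fun l => (hX.measure_follows hneg h1 l.2.1).1
  have hEP : ∀ l, P (E l) = wordWeight (jumpKernel (jumpLaw b)) 1 l.1 := fun l => by
    rw [hE, (hX.measure_follows hneg h1 l.2.1).2, wordWeight_congr hQ _ _ l.2.1]
  have hdisj : Pairwise (Function.onFun (AEDisjoint P) E) := by
    intro l l' hne
    refine Disjoint.aedisjoint (Set.disjoint_left.2 fun ω hω hω' => hne ?_)
    exact Subtype.ext (Follows.unique hω hω' l.2.1 l'.2.1)
  have hae : (⋃ l, E l) =ᵐ[P] {ω | extinctionTime X ω < ∞ ∧ totalDeaths X ω = k} := by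
    rw [eventuallyEq_set]
    filter_upwards [hX.ae_extinction_iff h1] with ω hω
    rw [Set.mem_iUnion]
    constructor
    · rintro ⟨l, hl⟩
      obtain ⟨h2, h3⟩ := Follows.extinction hl l.2.1
      exact ⟨h2, by rw [h3, l.2.2]⟩
    · rintro ⟨h2, h3⟩
      obtain ⟨l, hl, hf⟩ := hω h2
      refine ⟨⟨l, hl, ?_⟩, hf⟩
      rw [(hf.extinction hl).2] at h3
      exact_mod_cast h3
  refine ⟨(NullMeasurableSet.iUnion hEm).congr hae, ?_⟩
  have h0 : ENNReal.ofReal (r 0) = 0 := by rw [hr.zero, ENNReal.ofReal_zero]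
  rw [← measure_congr hae, measure_iUnion₀ hdisj hEm, tsum_congr hEP,
    tsum_subtype S (wordWeight (jumpKernel (jumpLaw b)) 1)]
  have := wordSum_eq_coeff h0 (hr.recursion hb) 1 k
  rw [pow_one, PowerSeries.coeff_mk] at this
  rw [← this, wordSum]
  exact tsum_congr fun l => (Set.indicator_apply _ _ _).trans (if_congr Iff.rfl rfl rfl)

end Regular

/-- The generating function of an `ℕ`-valued random variable with given point masses. -/
lemma integral_pow_eq_tsum {Ω : Type*} [MeasurableSpace Ω] {μ : Measure Ω} [IsFiniteMeasure μ]
    {N : Ω → ℕ} (hN : AEMeasurable N μ) {v : ℝ} (hv : v ∈ Set.Icc (0 : ℝ) 1) :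
    Integrable (fun ω => v ^ N ω) μ ∧ ∫ ω, v ^ N ω ∂μ = ∑' k, μ.real (N ⁻¹' {k}) * v ^ k := by
  have hint : Integrable (fun k : ℕ => v ^ k) (μ.map N) := by
    refine Integrable.of_bound (Measurable.of_discrete.aestronglyMeasurable) 1
      (ae_of_all _ fun k => ?_)
    rw [Real.norm_of_nonneg (pow_nonneg hv.1 k)]
    exact pow_le_one₀ hv.1 hv.2
  refine ⟨hint.comp_aemeasurable hN, ?_⟩
  rw [← integral_map (f := fun k : ℕ => v ^ k) hN hint.aestronglyMeasurable,
    integral_countable hint]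
  refine tsum_congr fun k => ?_
  rw [smul_eq_mul, map_measureReal_apply_of_aemeasurable hN (measurableSet_singleton k)]

/-- The law of the number of deaths for every regular chain whose embedded jump chain is, away from
`0`, the random walk with the jump law of `b`. -/
lemma IsRegularChain.hasDeathLaw {Ω : Type*} [MeasurableSpace Ω] {P : Measure Ω}
    [IsProbabilityMeasure P] {X : ℝ≥0 → Ω → ℕ} {b : ℕ → ℝ} (hb : IsRateSequence b)
    (hb0 : 0 < b 0) {ρ : ℝ} (hρ : IsLeast (nonnegRoots b) ρ) {r : ℕ → ℝ}
    (hr : IsDeathSequence b r) {Q : ℕ → ℕ → ℝ} (hX : IsRegularChain P Q X)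
    (hneg : ∀ i, i ≠ 0 → Q i i < 0)
    (hQ : ∀ i j, i ≠ 0 → i ≠ j → ENNReal.ofReal (Q i j / -Q i i) = jumpKernel (jumpLaw b) i j)
    (h1 : ∀ᵐ ω ∂P, X 0 ω = 1) : HasDeathLaw P X ρ r := by
  have hsum : HasSum r ρ := by
    obtain ⟨ρ', hρ', h⟩ := hr.exists_isLeast hb
    rwa [hρ.unique hρ']
  have hr0 := hr.nonneg hb
  have hρpos : 0 < ρ := by
    have h2 : 0 < r 1 := by
      rw [hr.one, neg_inv]
      exact mul_pos (inv_pos.2 hb.neg_one_pos) hb0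
    exact h2.trans_le (le_hasSum hsum 1 fun k _ => hr0 k)
  set D : Set Ω := {ω | extinctionTime X ω < ∞} with hD
  set B : ℕ → Set Ω := fun k => {ω | extinctionTime X ω < ∞ ∧ totalDeaths X ω = k} with hB
  have hBm : ∀ k, NullMeasurableSet (B k) P := fun k =>
    (hX.measure_totalDeaths hb hr hneg hQ h1 k).1
  have hBP : ∀ k, P (B k) = ENNReal.ofReal (r k) := fun k =>
    (hX.measure_totalDeaths hb hr hneg hQ h1 k).2
  have hfinite : ∀ᵐ ω ∂P, ω ∈ D → ∃ k : ℕ, totalDeaths X ω = k := by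
    filter_upwards [hX.ae_extinction_iff h1] with ω hω hωD
    obtain ⟨l, hl, hf⟩ := hω hωD
    exact ⟨_, (hf.extinction hl).2⟩
  have hDB : (⋃ k, B k) =ᵐ[P] D := by
    rw [eventuallyEq_set]
    filter_upwards [hfinite] with ω hω
    rw [Set.mem_iUnion]
    refine ⟨fun ⟨k, hk⟩ => hk.1, fun h => ?_⟩
    obtain ⟨k, hk⟩ := hω h
    exact ⟨k, h, hk⟩
  have hDm : NullMeasurableSet D P := (NullMeasurableSet.iUnion hBm).congr hDB
  have hDP : P D = ENNReal.ofReal ρ := by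
    rw [← measure_congr hDB, measure_iUnion₀ _ hBm, tsum_congr hBP,
      ← ENNReal.ofReal_tsum_of_nonneg hr0 hsum.summable, hsum.tsum_eq]
    intro k k' hk
    refine Disjoint.aedisjoint (Set.disjoint_left.2 fun ω hω hω' => hk ?_)
    exact_mod_cast hω.2.symm.trans hω'.2
  set ν := ProbabilityTheory.cond P D with hν
  have hlaw : ∀ k : ℕ, ν.real {ω | totalDeaths X ω = k} = ρ⁻¹ * r k := by
    intro k
    have h2 : {ω | totalDeaths X ω = k} ∩ D = B k := by
      ext ω
      exact and_comm
    rw [Measure.real, hν, ProbabilityTheory.cond, Measure.smul_apply, smul_eq_mul,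
      Measure.restrict_apply₀' hDm, h2, hBP, hDP, ENNReal.toReal_mul, ENNReal.toReal_inv,
      ENNReal.toReal_ofReal hρpos.le, ENNReal.toReal_ofReal (hr0 k)]
  have : IsProbabilityMeasure ν := ProbabilityTheory.cond_isProbabilityMeasure (by
    rw [hDP]
    exact (ENNReal.ofReal_pos.2 hρpos).ne')
  have hac : ν ≪ P := ProbabilityTheory.cond_absolutelyContinuous
  set N : Ω → ℕ := fun ω => (totalDeaths X ω).toNat with hNdef
  -- Under the conditional law the number of deaths is finite, so `toNat` loses nothing.
  have hNk : ∀ k : ℕ, ∀ᵐ ω ∂ν, (ω ∈ B k ↔ N ω = k) ∧ (totalDeaths X ω = k ↔ N ω = k) := by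
    intro k
    filter_upwards [ProbabilityTheory.ae_cond_mem₀ hDm, hac.ae_le hfinite] with ω hωD hω
    obtain ⟨n, hn⟩ := hω hωD
    have h2 : totalDeaths X ω = k ↔ N ω = k := by
      rw [hNdef]
      simp only [hn, ENat.toNat_natCast, Nat.cast_inj]
    exact ⟨(and_iff_right hωD).trans h2, h2⟩
  have hNm : AEMeasurable N ν := by
    refine NullMeasurable.aemeasurable fun s _ => ?_
    have hs : N ⁻¹' s = ⋃ k ∈ s, N ⁻¹' {k} := by
      rw [← Set.preimage_iUnion₂, Set.biUnion_of_singleton]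
    rw [hs]
    refine NullMeasurableSet.biUnion (Set.to_countable s) fun k _ => ?_
    refine ((hBm k).mono_ac hac).congr ?_
    rw [eventuallyEq_set]
    filter_upwards [hNk k] with ω hω using hω.1
  have hNlaw : ∀ k, ν.real (N ⁻¹' {k}) = ρ⁻¹ * r k := by
    intro k
    rw [← hlaw k]
    refine measureReal_congr ?_
    rw [eventuallyEq_set]
    filter_upwards [hNk k] with ω hω using hω.2.symm
  refine ⟨hlaw, fun v hv => (integral_pow_eq_tsum hNm hv).1, fun v hv => ?_, fun v hv => ?_⟩
  · refine hsum.summable.of_nonneg_of_le (fun k => mul_nonneg (hr0 k) (pow_nonneg hv.1 k))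
      fun k => mul_le_of_le_one_right (hr0 k) (pow_le_one₀ hv.1 hv.2)
  · rw [(integral_pow_eq_tsum hNm hv).2, ← tsum_mul_left]
    refine tsum_congr fun k => ?_
    rw [hNlaw, mul_assoc]

/-! ### The three processes -/

lemma wmbMatrix_self {b w : ℕ → ℝ} {i : ℕ} (hi : i ≠ 0) : wmbMatrix b w i i = w i * b 1 := by
  rw [wmbMatrix, if_pos (by omega), Nat.add_sub_cancel_left]

lemma wmbMatrix_self_neg {b w : ℕ → ℝ} (hb : IsRateSequence b) (hw : ∀ i, 1 ≤ i → 0 < w i) {i : ℕ}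
    (hi : i ≠ 0) : wmbMatrix b w i i < 0 := by
  rw [wmbMatrix_self hi]
  exact mul_neg_of_pos_of_neg (hw i (by omega)) (by linarith [hb.neg_one_pos])

/-- The weights cancel in the jump probabilities. -/
lemma ofReal_wmbMatrix_div {b w : ℕ → ℝ} (hw : ∀ i, 1 ≤ i → 0 < w i) {i : ℕ} (hi : i ≠ 0) (j : ℕ) :
    ENNReal.ofReal (wmbMatrix b w i j / -wmbMatrix b w i i) = jumpKernel (jumpLaw b) i j := by
  rw [wmbMatrix_self hi, jumpKernel, wmbMatrix]
  by_cases h : i ≤ j + 1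
  · rw [if_pos ⟨by omega, h⟩, if_pos h, jumpLaw, ← mul_neg,
      mul_div_mul_left _ _ (hw i (by omega)).ne']
  · rw [if_neg fun h' => h h'.2, if_neg h, zero_div, ENNReal.ofReal_zero]

lemma queueMatrix_of_ne_zero {b : ℕ → ℝ} {i : ℕ} (hi : i ≠ 0) (j : ℕ) :
    queueMatrix b i j = wmbMatrix b (fun _ => 1) i j := if_neg hi

end WMBP

theorem corollary3p1 (b : ℕ → ℝ) (hb : WMBP.IsRateSequence b) (hb0 : 0 < b 0) :
    (∃ ρ : ℝ, IsLeast (WMBP.nonnegRoots b) ρ) ∧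
    (∃! r : ℕ → ℝ, WMBP.IsDeathSequence b r) ∧
    ∀ (ρ : ℝ) (r : ℕ → ℝ), IsLeast (WMBP.nonnegRoots b) ρ → WMBP.IsDeathSequence b r →
      ∀ {Ω : Type*} [MeasurableSpace Ω] (P : MeasureTheory.Measure Ω)
        [MeasureTheory.IsProbabilityMeasure P] (X : NNReal → Ω → ℕ),
        (∀ᵐ ω ∂P, X 0 ω = 1) →
          (∀ w : ℕ → ℝ, (∀ i, 1 ≤ i → 0 < w i) →
            WMBP.IsWeightedMarkovBranchingProcess P b w X → WMBP.HasDeathLaw P X ρ r) ∧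
          (WMBP.IsMarkovBranchingProcess P b X → WMBP.HasDeathLaw P X ρ r) ∧
          (WMBP.IsMXM1Queue P b X → WMBP.HasDeathLaw P X ρ r) := by
  obtain ⟨r₀, hr₀, -⟩ := WMBP.exists_isDeathSequence hb
  obtain ⟨ρ₀, hρ₀, -⟩ := hr₀.exists_isLeast hb
  refine ⟨⟨ρ₀, hρ₀⟩, ⟨r₀, hr₀, fun r hr => hr.unique hr₀⟩, ?_⟩
  intro ρ r hρ hr Ω _ P _ X h1
  have hw : ∀ w : ℕ → ℝ, (∀ i, 1 ≤ i → 0 < w i) →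
      WMBP.IsWeightedMarkovBranchingProcess P b w X → WMBP.HasDeathLaw P X ρ r := fun w hw hX =>
    WMBP.IsRegularChain.hasDeathLaw hb hb0 hρ hr hX (fun i hi => WMBP.wmbMatrix_self_neg hb hw hi)
      (fun i j hi _ => WMBP.ofReal_wmbMatrix_div hw hi j) h1
  refine ⟨hw, hw _ fun i hi => Nat.cast_pos.2 hi, fun hX => ?_⟩
  refine WMBP.IsRegularChain.hasDeathLaw hb hb0 hρ hr hX (fun i hi => ?_) (fun i j hi _ => ?_) h1
  · rw [WMBP.queueMatrix_of_ne_zero hi]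
    exact WMBP.wmbMatrix_self_neg hb (fun _ _ => one_pos) hi
  · rw [WMBP.queueMatrix_of_ne_zero hi, WMBP.queueMatrix_of_ne_zero hi]
    exact WMBP.ofReal_wmbMatrix_div (fun _ _ => one_pos) hi j
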